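/- For a finite-dimensional real Lie algebra $\mathfrak g$, let $\mu(\mathfrak g)$ be the least $n$ for which $\mathfrak g$ has a faithful representation in $\mathfrak{gl}(n,\mathbb R)$, that is, an injective homomorphism of Lie algebras $\mathfrak g\to\mathfrak{gl}(n,\mathbb R)$. Let $R_5$ be the irreducible $5$-dimensional real representation of $\mathfrak{so}(3)$, and $D_2$ the irreducible $5$-dimensional real representation of $\mathfrak{sl}(2,\mathbb R)$. Let $$L_{8.5}=\mathfrak{so}(3)\ltimes_{R_5}\mathbb R^5,\qquad L_{8.21}=\mathfrak{sl}(2,\mathbb R)\ltimes_{D_2}\mathbb R^5$$ be the semidirect products in which $\mathbb R^5$ is an abelian ideal on which the simple factor acts by $R_5$, respectively by $D_2$. Then: 1. Neither $L_{8.5}$ nor $L_{8.21}$ has a faithful representation in $\mathfrak{gl}(5,\mathbb R)$, and $\mu(L_{8.5})=\mu(L_{8.21})=6$. 2. For every representation $\varphi:\mathfrak{so}(3)\to\mathfrak{gl}(5,\mathbb R)$ there is no linear subspace $W\subset\mathfrak{gl}(5,\mathbb R)$ of pairwise commuting matrices that is invariant under the commutator action $X\mapsto[\varphi(A),X]$,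 $A\in\mathfrak{so}(3)$, and on which this action is equivalent to $R_5$. Likewise, for every representation $\varphi:\mathfrak{sl}(2,\mathbb R)\to\mathfrak{gl}(5,\mathbb R)$ there is no such subspace on which the commutator action of $\mathfrak{sl}(2,\mathbb R)$ is equivalent to $D_2$. -/

import Mathlib

namespace LeviRep

open Matrix

attribute [local instance 100] LieRing.ofAssociativeRing

/-- A representation of a real Lie algebra on `ℝⁿ`, written in matrices: a homomorphism of Lie
algebras into `gl(n, ℝ)`. -/
abbrev MatRep (L : Type*) [LieRing L] [LieAlgebra ℝ L] (n : ℕ) : Type _ :=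
  L →ₗ⁅ℝ⁆ Matrix (Fin n) (Fin n) ℝ

/-- `L` has a faithful representation in `gl(n, ℝ)`. -/
def HasFaithfulRep (L : Type*) [LieRing L] [LieAlgebra ℝ L] (n : ℕ) : Prop :=
  ∃ φ : MatRep L n, Function.Injective φ

/-- The smallest `n` such that `L` has a faithful representation in `gl(n, ℝ)` (and `0` if there
is no such `n`). -/
noncomputable def mu (L : Type*) [LieRing L] [LieAlgebra ℝ L] : ℕ :=
  sInf {n : ℕ | HasFaithfulRep L n}

/-- A representation on `ℝⁿ` is irreducible if `n ≠ 0` and the only invariant subspaces are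
`0` and `ℝⁿ`. -/
def IsIrreducibleRep {L : Type*} [LieRing L] [LieAlgebra ℝ L] {n : ℕ} (ρ : MatRep L n) : Prop :=
  n ≠ 0 ∧ ∀ W : Submodule ℝ (Fin n → ℝ), (∀ A : L, ∀ v ∈ W, ρ A *ᵥ v ∈ W) → W = ⊥ ∨ W = ⊤

/-- The Lie bracket on `ℝⁿ` that is used here, the commutator for the componentwise product, is
zero: `ℝⁿ` is the abelian Lie algebra. -/
theorem lie_pi_eq_zero {n : ℕ} (v w : Fin n → ℝ) : ⁅v, w⁆ = 0 := by
  ext i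
  simp [Ring.lie_def, mul_comm]

/-- Every matrix acts as a derivation of the abelian Lie algebra `ℝⁿ`. -/
def derivOfMatrix {n : ℕ} (M : Matrix (Fin n) (Fin n) ℝ) :
    LieDerivation ℝ (Fin n → ℝ) (Fin n → ℝ) where
  toLinearMap := M.mulVecLin
  leibniz' v w := by simp only [lie_pi_eq_zero, map_zero, sub_zero]

/-- A representation on `ℝⁿ` as an action by derivations of the abelian Lie algebra `ℝⁿ`. -/
def derivOfRep {L : Type*} [LieRing L] [LieAlgebra ℝ L] {n : ℕ} (ρ : MatRep L n) :
    L →ₗ⁅ℝ⁆ LieDerivation ℝ (Fin n → ℝ) (Fin n → ℝ) where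
  toFun A := derivOfMatrix (ρ A)
  map_add' A B := by
    ext v : 1
    simp [derivOfMatrix]
  map_smul' c A := by
    ext v : 1
    simp [derivOfMatrix]
  map_lie' {A B} := by
    ext v : 1
    simp [derivOfMatrix, Ring.lie_def, Matrix.mulVec_mulVec]

/-- The semidirect product `L ⋉ ℝⁿ`, with `ℝⁿ` an abelian ideal on which `L` acts by `ρ`. -/
abbrev SemidirectByRep {L : Type*} [LieRing L] [LieAlgebra ℝ L] {n : ℕ} (ρ : MatRep L n) : Type _ :=
  LieAlgebra.SemiDirectSum (Fin n → ℝ) L (derivOfRep ρ)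

/-- Check of the bracket: `[(v, A), (w, B)] = (ρ(A) w - ρ(B) v, [A, B])`. -/
theorem semidirect_lie {L : Type*} [LieRing L] [LieAlgebra ℝ L] {n : ℕ} (ρ : MatRep L n)
    (x y : SemidirectByRep ρ) :
    ⁅x, y⁆ = ⟨ρ x.right *ᵥ y.left - ρ y.right *ᵥ x.left, ⁅x.right, y.right⁆⟩ := by
  rw [LieAlgebra.SemiDirectSum.lie_eq_mk, lie_pi_eq_zero, zero_add]
  rfl

/-- `so(3)`: skew-symmetric real `3 × 3` matrices. -/
abbrev so3 : Type := LieAlgebra.Orthogonal.so (Fin 3) ℝ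

/-- `sl(2, ℝ)`: real `2 × 2` matrices of trace zero. -/
abbrev sl2 : Type := LieAlgebra.SpecialLinear.sl (Fin 2) ℝ

theorem so3_apply (A : so3) (i j : Fin 3) : A.1 i j = - A.1 j i := by
  have h := (LieAlgebra.Orthogonal.mem_so (Fin 3) ℝ A.1).1 A.2
  have := congrFun (congrFun h j) i
  simpa using this

theorem sl2_apply (A : sl2) : A.1 1 1 = - A.1 0 0 := by
  have h : Matrix.trace A.1 = 0 := A.2
  rw [Matrix.trace_fin_two] at h
  linarith

/-- The matrix of the representation `R₅` of `so(3)`, where `a = A₁₂ / 2`, `b = A₂₀ / 2`,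
`c = A₀₁`. -/
def R5Matrix (a b c : ℝ) : Matrix (Fin 5) (Fin 5) ℝ :=
  !![     0, 2 * c,  4 * b, 4 * a,      0;
     -2 * c,     0, -4 * a, 4 * b,      0;
         -b,     a,      0,     c, -6 * a;
         -a,    -b,     -c,     0, -6 * b;
          0,     0,  2 * a, 2 * b,      0]

/-- The matrix of the representation `D₂` of `sl(2, ℝ)`, at the element with rows `(a, b)` and
`(c, -a)`. -/
def D2Matrix (a b c : ℝ) : Matrix (Fin 5) (Fin 5) ℝ :=
  !![4 * a, 4 * b,     0,      0,      0;
         c, 2 * a, 3 * b,      0,      0;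
         0, 2 * c,     0,  2 * b,      0;
         0,     0, 3 * c, -2 * a,      b;
         0,     0,     0,  4 * c, -4 * a]

theorem R5Matrix_mulVec (a b c x y z t u : ℝ) : R5Matrix a b c *ᵥ ![x, y, z, t, u] =
    ![2 * c * y + 4 * b * z + 4 * a * t, -2 * c * x - 4 * a * z + 4 * b * t,
      -b * x + a * y + c * t - 6 * a * u, -a * x - b * y - c * z - 6 * b * u,
      2 * a * z + 2 * b * t] := by
  ext i
  fin_cases i <;> simp [R5Matrix, Matrix.mulVec, dotProduct, Fin.sum_univ_five] <;> ring

theorem D2Matrix_mulVec (a b c x y z t u : ℝ) : D2Matrix a b c *ᵥ ![x, y, z, t, u] =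
    ![4 * a * x + 4 * b * y, c * x + 2 * a * y + 3 * b * z, 2 * c * y + 2 * b * t,
      3 * c * z - 2 * a * t + b * u, 4 * c * t - 4 * a * u] := by
  ext i
  fin_cases i <;> simp [D2Matrix, Matrix.mulVec, dotProduct, Fin.sum_univ_five] <;> ring

theorem vec5_eta (v : Fin 5 → ℝ) : v = ![v 0, v 1, v 2, v 3, v 4] := by
  ext i
  fin_cases i <;> rfl

theorem R5Matrix_lie (a b c a' b' c' : ℝ) :
    R5Matrix a b c * R5Matrix a' b' c' - R5Matrix a' b' c' * R5Matrix a b c =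
      R5Matrix (c * b' - b * c') (a * c' - c * a') (4 * (b * a' - a * b')) := by
  refine Matrix.mulVec_injective (funext fun v => ?_)
  rw [vec5_eta v, Matrix.sub_mulVec, ← Matrix.mulVec_mulVec, ← Matrix.mulVec_mulVec]
  simp only [R5Matrix_mulVec]
  ext i
  fin_cases i <;> simp <;> ring

theorem D2Matrix_lie (a b c a' b' c' : ℝ) :
    D2Matrix a b c * D2Matrix a' b' c' - D2Matrix a' b' c' * D2Matrix a b c =
      D2Matrix (b * c' - c * b') (2 * (a * b' - b * a')) (2 * (c * a' - a * c')) := by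
  refine Matrix.mulVec_injective (funext fun v => ?_)
  rw [vec5_eta v, Matrix.sub_mulVec, ← Matrix.mulVec_mulVec, ← Matrix.mulVec_mulVec]
  simp only [D2Matrix_mulVec]
  ext i
  fin_cases i <;> simp <;> ring

theorem so3_lie (A B : so3) :
    (⁅A, B⁆ : so3).1 1 2 = A.1 0 1 * B.1 2 0 - A.1 2 0 * B.1 0 1 ∧
    (⁅A, B⁆ : so3).1 2 0 = A.1 1 2 * B.1 0 1 - A.1 0 1 * B.1 1 2 ∧
    (⁅A, B⁆ : so3).1 0 1 = A.1 2 0 * B.1 1 2 - A.1 1 2 * B.1 2 0 := by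
  have hA0 := so3_apply A 0 0
  have hA1 := so3_apply A 1 1
  have hA2 := so3_apply A 2 2
  have hB0 := so3_apply B 0 0
  have hB1 := so3_apply B 1 1
  have hB2 := so3_apply B 2 2
  have hA0 : A.1 0 0 = 0 := by linarith
  have hA1 : A.1 1 1 = 0 := by linarith
  have hA2 : A.1 2 2 = 0 := by linarith
  have hB0 : B.1 0 0 = 0 := by linarith
  have hB1 : B.1 1 1 = 0 := by linarith
  have hB2 : B.1 2 2 = 0 := by linarith
  have h : (⁅A, B⁆ : so3).1 = A.1 * B.1 - B.1 * A.1 := rfl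
  rw [h]
  simp only [Matrix.sub_apply, Matrix.mul_apply, Fin.sum_univ_three, hA0, hA1, hA2, hB0, hB1, hB2,
    so3_apply A 1 0, so3_apply A 2 1, so3_apply A 0 2, so3_apply B 1 0, so3_apply B 2 1,
    so3_apply B 0 2]
  refine ⟨?_, ?_, ?_⟩ <;> ring

theorem sl2_lie (A B : sl2) :
    (⁅A, B⁆ : sl2).1 0 0 = A.1 0 1 * B.1 1 0 - A.1 1 0 * B.1 0 1 ∧
    (⁅A, B⁆ : sl2).1 0 1 = 2 * (A.1 0 0 * B.1 0 1 - A.1 0 1 * B.1 0 0) ∧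
    (⁅A, B⁆ : sl2).1 1 0 = 2 * (A.1 1 0 * B.1 0 0 - A.1 0 0 * B.1 1 0) := by
  have h : (⁅A, B⁆ : sl2).1 = A.1 * B.1 - B.1 * A.1 := rfl
  rw [h]
  simp only [Matrix.sub_apply, Matrix.mul_apply, Fin.sum_univ_two, sl2_apply A, sl2_apply B]
  refine ⟨?_, ?_, ?_⟩ <;> ring

/-- `R₅`, the irreducible `5`-dimensional representation of `so(3)`. -/
noncomputable def R5 : MatRep so3 5 where
  toFun A := R5Matrix (A.1 1 2 / 2) (A.1 2 0 / 2) (A.1 0 1)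
  map_add' A B := by
    ext i j
    fin_cases i <;> fin_cases j <;> simp [R5Matrix] <;> ring
  map_smul' c A := by
    ext i j
    fin_cases i <;> fin_cases j <;> simp [R5Matrix] <;> ring
  map_lie' {A B} := by
    obtain ⟨h1, h2, h3⟩ := so3_lie A B
    simp only [h1, h2, h3]
    rw [Ring.lie_def, R5Matrix_lie]
    congr 1 <;> ring

/-- `D₂`, the irreducible `5`-dimensional representation of `sl(2, ℝ)`. -/
noncomputable def D2 : MatRep sl2 5 where
  toFun A := D2Matrix (A.1 0 0) (A.1 0 1) (A.1 1 0)
  map_add' A B := by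
    ext i j
    fin_cases i <;> fin_cases j <;> simp [D2Matrix] <;> ring
  map_smul' c A := by
    ext i j
    fin_cases i <;> fin_cases j <;> simp [D2Matrix] <;> ring
  map_lie' {A B} := by
    obtain ⟨h1, h2, h3⟩ := sl2_lie A B
    simp only [h1, h2, h3]
    rw [Ring.lie_def, D2Matrix_lie]

theorem eq_top_of_basis {W : Submodule ℝ (Fin 5 → ℝ)} (h0 : ![1, 0, 0, 0, 0] ∈ W)
    (h1 : ![0, 1, 0, 0, 0] ∈ W) (h2 : ![0, 0, 1, 0, 0] ∈ W) (h3 : ![0, 0, 0, 1, 0] ∈ W)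
    (h4 : ![0, 0, 0, 0, 1] ∈ W) : W = ⊤ := by
  refine Submodule.eq_top_iff'.2 fun v => ?_
  have h := W.add_mem (W.add_mem (W.add_mem (W.add_mem (W.smul_mem (v 0) h0) (W.smul_mem (v 1) h1))
    (W.smul_mem (v 2) h2)) (W.smul_mem (v 3) h3)) (W.smul_mem (v 4) h4)
  convert h using 1
  ext i
  fin_cases i <;> simp

/-- The matrices above do define an irreducible representation of `so(3)`. -/
theorem R5_irreducible : IsIrreducibleRep R5 := by
  refine ⟨by norm_num, fun W hW => ?_⟩
  have hM : ∀ a b c x y z t u : ℝ, ![x, y, z, t, u] ∈ W →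
      ![2 * c * y + 4 * b * z + 4 * a * t, -2 * c * x - 4 * a * z + 4 * b * t,
      -b * x + a * y + c * t - 6 * a * u, -a * x - b * y - c * z - 6 * b * u,
      2 * a * z + 2 * b * t] ∈ W := by
    intro a b c x y z t u h
    have hA : !![0, c, -(2 * b); -c, 0, 2 * a; 2 * b, -(2 * a), 0] ∈
        LieAlgebra.Orthogonal.so (Fin 3) ℝ := by
      rw [LieAlgebra.Orthogonal.mem_so]
      ext i j
      fin_cases i <;> fin_cases j <;> simp
    have := hW ⟨_, hA⟩ _ h
    have e : R5 ⟨_, hA⟩ = R5Matrix a b c := by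
      change R5Matrix (2 * a / 2) (2 * b / 2) c = _
      congr 1 <;> ring
    rwa [e, R5Matrix_mulVec] at this
  by_cases h5 : ∃ x y z t u : ℝ, u ≠ 0 ∧ ![x, y, z, t, u] ∈ W
  · right
    obtain ⟨x, y, z, t, u, hu, h⟩ := h5
    have c1 := hM 0 0 1 _ _ _ _ _ h
    have c2 := hM 0 0 1 _ _ _ _ _ c1
    have c3 := hM 0 0 1 _ _ _ _ _ c2
    have c4 := hM 0 0 1 _ _ _ _ _ c3
    have e5 := W.smul_mem (1 / (4 * u)) (W.add_mem (W.add_mem c4 (W.smul_mem 5 c2))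
      (W.smul_mem 4 h))
    have e5 : ![0, 0, 0, 0, 1] ∈ W := by
      convert e5 using 1
      ext i
      fin_cases i <;> simp <;> first | (field_simp; done) | (ring_nf; done) | (right; ring)
    have e3 : ![0, 0, 1, 0, 0] ∈ W := by
      convert W.smul_mem (-1 / 6) (hM 1 0 0 _ _ _ _ _ e5) using 1
      ext i
      fin_cases i <;> simp
    have e4 : ![0, 0, 0, 1, 0] ∈ W := by
      convert W.smul_mem (-1 / 6) (hM 0 1 0 _ _ _ _ _ e5) using 1
      ext i
      fin_cases i <;> simp
    have e1 : ![1, 0, 0, 0, 0] ∈ W := by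
      convert W.smul_mem (1 / 4) (hM 1 0 0 _ _ _ _ _ e4) using 1
      ext i
      fin_cases i <;> simp
    have e2 : ![0, 1, 0, 0, 0] ∈ W := by
      convert W.smul_mem (-1 / 2) (hM 0 0 1 _ _ _ _ _ e1) using 1
      ext i
      fin_cases i <;> simp
    exact eq_top_of_basis e1 e2 e3 e4 e5
  · left
    have hz : ∀ x y z t u : ℝ, ![x, y, z, t, u] ∈ W → u = 0 := by
      intro x y z t u h
      by_contra hu
      exact h5 ⟨x, y, z, t, u, hu, h⟩
    refine (Submodule.eq_bot_iff W).2 fun v hv => ?_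
    rw [vec5_eta v] at hv
    have h4 := hz _ _ _ _ _ hv
    have a1 := hM 1 0 0 _ _ _ _ _ hv
    have b1 := hM 0 1 0 _ _ _ _ _ hv
    have h2 := hz _ _ _ _ _ a1
    have h3 := hz _ _ _ _ _ b1
    have h1 := hz _ _ _ _ _ (hM 1 0 0 _ _ _ _ _ a1)
    have h0 := hz _ _ _ _ _ (hM 0 1 0 _ _ _ _ _ a1)
    ext i
    fin_cases i <;> simp <;> linarith

/-- The matrices above do define an irreducible representation of `sl(2, ℝ)`. -/
theorem D2_irreducible : IsIrreducibleRep D2 := by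
  refine ⟨by norm_num, fun W hW => ?_⟩
  have hM : ∀ a b c x y z t u : ℝ, ![x, y, z, t, u] ∈ W →
      ![4 * a * x + 4 * b * y, c * x + 2 * a * y + 3 * b * z, 2 * c * y + 2 * b * t,
      3 * c * z - 2 * a * t + b * u, 4 * c * t - 4 * a * u] ∈ W := by
    intro a b c x y z t u h
    have hA : !![a, b; c, -a] ∈ LieAlgebra.SpecialLinear.sl (Fin 2) ℝ := by
      change Matrix.trace !![a, b; c, -a] = 0
      simp [Matrix.trace_fin_two]
    have := hW ⟨_, hA⟩ _ h
    have e : D2 ⟨_, hA⟩ = D2Matrix a b c := rfl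
    rwa [e, D2Matrix_mulVec] at this
  by_cases h5 : ∃ x y z t u : ℝ, u ≠ 0 ∧ ![x, y, z, t, u] ∈ W
  · right
    obtain ⟨x, y, z, t, u, hu, h⟩ := h5
    have c1 := hM 0 1 0 _ _ _ _ _ h
    have c2 := hM 0 1 0 _ _ _ _ _ c1
    have c3 := hM 0 1 0 _ _ _ _ _ c2
    have c4 := hM 0 1 0 _ _ _ _ _ c3
    have e1 : ![1, 0, 0, 0, 0] ∈ W := by
      convert W.smul_mem (1 / (24 * u)) c4 using 1
      ext i
      fin_cases i <;> simp
      field_simp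
      norm_num
    have e2 : ![0, 1, 0, 0, 0] ∈ W := by
      convert hM 0 0 1 _ _ _ _ _ e1 using 1
      ext i
      fin_cases i <;> simp
    have e3 : ![0, 0, 1, 0, 0] ∈ W := by
      convert W.smul_mem (1 / 2) (hM 0 0 1 _ _ _ _ _ e2) using 1
      ext i
      fin_cases i <;> simp
    have e4 : ![0, 0, 0, 1, 0] ∈ W := by
      convert W.smul_mem (1 / 3) (hM 0 0 1 _ _ _ _ _ e3) using 1
      ext i
      fin_cases i <;> simp
    have e5 : ![0, 0, 0, 0, 1] ∈ W := by
      convert W.smul_mem (1 / 4) (hM 0 0 1 _ _ _ _ _ e4) using 1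
      ext i
      fin_cases i <;> simp
    exact eq_top_of_basis e1 e2 e3 e4 e5
  · left
    have hz : ∀ x y z t u : ℝ, ![x, y, z, t, u] ∈ W → u = 0 := by
      intro x y z t u h
      by_contra hu
      exact h5 ⟨x, y, z, t, u, hu, h⟩
    refine (Submodule.eq_bot_iff W).2 fun v hv => ?_
    rw [vec5_eta v] at hv
    have h4 := hz _ _ _ _ _ hv
    have f1 := hM 0 0 1 _ _ _ _ _ hv
    have f2 := hM 0 0 1 _ _ _ _ _ f1
    have f3 := hM 0 0 1 _ _ _ _ _ f2
    have f4 := hM 0 0 1 _ _ _ _ _ f3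
    have h3 := hz _ _ _ _ _ f1
    have h2 := hz _ _ _ _ _ f2
    have h1 := hz _ _ _ _ _ f3
    have h0 := hz _ _ _ _ _ f4
    ext i
    fin_cases i <;> simp <;> linarith

/-- `L_{8.5} = so(3) ⋉ ℝ⁵`, with `so(3)` acting on `ℝ⁵` by `R₅`. -/
abbrev L85 : Type := SemidirectByRep R5

/-- `L_{8.21} = sl(2, ℝ) ⋉ ℝ⁵`, with `sl(2, ℝ)` acting on `ℝ⁵` by `D₂`. -/
abbrev L821 : Type := SemidirectByRep D2

/-- Given representations `φ : L → gl(N, ℝ)` and `ρ : L → gl(n, ℝ)`: there is a subspace `W` of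
`gl(N, ℝ)`, consisting of pairwise commuting matrices and invariant under the commutator action
`X ↦ [φ(A), X]` of `L`, on which this action is equivalent to `ρ`. -/
def HasCommutingCopy {L : Type*} [LieRing L] [LieAlgebra ℝ L] {N n : ℕ}
    (φ : MatRep L N) (ρ : MatRep L n) : Prop :=
  ∃ W : Submodule ℝ (Matrix (Fin N) (Fin N) ℝ),
    (∀ A : L, ∀ X ∈ W, ⁅φ A, X⁆ ∈ W) ∧
    (∀ X ∈ W, ∀ Y ∈ W, ⁅X, Y⁆ = 0) ∧
    ∃ e : (Fin n → ℝ) ≃ₗ[ℝ] W, ∀ (A : L) (v : Fin n → ℝ),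
      (e (ρ A *ᵥ v) : Matrix (Fin N) (Fin N) ℝ) = ⁅φ A, (e v : Matrix (Fin N) (Fin N) ℝ)⁆

end LeviRep

/-! Upper bound: affine maps with linear part `ρ A` and translation part `v` represent `L ⋉ ℝⁿ`
faithfully in `gl(n + 1, ℝ)` whenever `ρ` is faithful (`hasFaithfulRep_semidirect`).

Lower bound: a faithful representation of `L ⋉ ℝⁿ` in `gl(N, ℝ)` carries the ideal `ℝⁿ` to a
commuting copy of `ρ`, so everything follows from the absence of such copies for `N ≤ 5`. After
complexification both cases become one statement about an `sl₂`-triple `H, E, F` acting on `V` with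
`dim V ≤ 5` and a commuting stable space `W` generated under `F` by some `X` of weight `4`
(`eq_zero_of_weight_four`).

There `X` is nilpotent since it shifts weights, and nilpotency passes from `Y` to `[F, Y]`
(`isNilpotent_commutator`), so `W` consists of commuting nilpotents. Let `U` be the common kernel of
`W` and `U'` the space of vectors that `W` maps into `U`. If `X ≠ 0`, then `U'` is strictly larger
than `U` and `X` does not kill `U'`. Hence `X` moves some weight `n` of `V ⧸ U` to the weight `n +
4` of `U`. Weights are smaller than the dimension in absolute value, so `4 ≤ |n| + |n + 4| ≤ dim V -
2`, which is impossible. -/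

namespace LeviRep

open Matrix

attribute [local instance 100] LieRing.ofAssociativeRing

/-! ### Nilpotency under inner derivations. -/

section Nilpotent

variable {R : Type*} [Ring R]

theorem commutator_pow_succ {d x y : R} (hy : d * x - x * d = y) (hxy : Commute x y) (m : ℕ) :
    d * x ^ (m + 1) - x ^ (m + 1) * d = (m + 1) • (x ^ m * y) := by
  induction m with
  | zero => simp [hy]
  | succ m ih =>
    have h1 : d * x ^ (m + 1 + 1) - x ^ (m + 1 + 1) * d =
        (d * x ^ (m + 1) - x ^ (m + 1) * d) * x + x ^ (m + 1) * (d * x - x * d) := by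
      rw [pow_succ x (m + 1)]; noncomm_ring
    rw [h1, ih, hy, smul_mul_assoc, mul_assoc, ← hxy.eq, ← mul_assoc, ← pow_succ,
      succ_nsmul _ (m + 1)]

/-- The extra factor `y` on the left avoids the exponent `m - 1`. -/
theorem commutator_pow_mul {d y z : R} (hz : d * y - y * d = z) (hyz : Commute y z) (m : ℕ) :
    (d * y ^ m - y ^ m * d) * y = m • (y ^ m * z) := by
  cases m with
  | zero => simp
  | succ m =>
    rw [commutator_pow_succ hz hyz, smul_mul_assoc, mul_assoc, ← hyz.eq, ← mul_assoc, ← pow_succ]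

/-- An inner derivation maps a nilpotent element to a nilpotent element, provided that the
element and its first two derivatives commute. -/
theorem isNilpotent_commutator [IsAddTorsionFree R] {d x y z : R} (hy : d * x - x * d = y)
    (hz : d * y - y * d = z) (hxy : Commute x y) (hyz : Commute y z) (hx : IsNilpotent x) :
    IsNilpotent y := by
  obtain ⟨n, hn⟩ := hx
  -- Trade one factor `x` for two factors `y`: differentiate `x ^ (j + 1) * y ^ (2 * k) = 0` and
  -- multiply by `y`. The term containing `z` still has this product as a factor, so `(j + 1) • x ^
  -- j * y ^ (2 * k + 2)` vanishes.
  have key : ∀ k j, j + k = n → x ^ j * y ^ (2 * k) = 0 := by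
    intro k
    induction k with
    | zero => rintro j rfl; simpa using hn
    | succ k ih =>
      intro j hj
      have h := ih (j + 1) (by omega)
      have h2 : (d * x ^ (j + 1) - x ^ (j + 1) * d) * y ^ (2 * k) * y +
          x ^ (j + 1) * ((d * y ^ (2 * k) - y ^ (2 * k) * d) * y) =
          d * (x ^ (j + 1) * y ^ (2 * k)) * y - (x ^ (j + 1) * y ^ (2 * k)) * d * y := by
        noncomm_ring
      rw [h, commutator_pow_succ hy hxy, commutator_pow_mul hz hyz, mul_smul_comm, ← mul_assoc,
        h] at h2
      simp only [zero_mul, mul_zero, smul_zero, add_zero, sub_zero, smul_mul_assoc] at h2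
      rw [smul_eq_zero_iff_right (Nat.succ_ne_zero j)] at h2
      rw [← h2, show 2 * (k + 1) = 1 + 2 * k + 1 by ring, pow_succ, pow_add]
      simp only [mul_assoc, pow_one]
  exact ⟨2 * n, by simpa using key n 0 (by simp)⟩

end Nilpotent

/-! ### Commuting nilpotents and weights of `sl₂`-triples. -/

section Modules

open Module

variable {V : Type*} [AddCommGroup V] [Module ℂ V]

/-- Commuting nilpotent endomorphisms preserving a proper subspace `P` have a common null vector
modulo `P`. -/
theorem exists_notMem_forall_apply_mem {P : Submodule ℂ V} (hP : P ≠ ⊤) (s : Finset (End ℂ V))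
    (hcomm : ∀ X ∈ s, ∀ Y ∈ s, Commute X Y) (hnil : ∀ X ∈ s, IsNilpotent X)
    (hinv : ∀ X ∈ s, ∀ v ∈ P, X v ∈ P) : ∃ v ∉ P, ∀ X ∈ s, X v ∈ P := by
  classical
  induction s using Finset.induction_on with
  | empty =>
    obtain ⟨v, -, hv⟩ := SetLike.exists_of_lt (lt_top_iff_ne_top.2 hP)
    exact ⟨v, hv, by simp⟩
  | insert A s hA ih =>
    simp only [Finset.forall_mem_insert] at hcomm hnil hinv
    obtain ⟨v, hv, hsv⟩ := ih (fun X hX Y hY => (hcomm.2 X hX).2 Y hY) hnil.2 hinv.2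
    have hinvpow : ∀ k : ℕ, ∀ u ∈ P, (A ^ k) u ∈ P := by
      intro k
      induction k with
      | zero => simp
      | succ k ihk => intro u hu; rw [pow_succ]; exact ihk _ (hinv.1 u hu)
    -- The last `A ^ k v` outside `P` works: `A ^ k` commutes with the elements of `s` and preserves
    -- `P`.
    obtain ⟨N, hN⟩ := hnil.1
    obtain ⟨k, hk, hk'⟩ := Nat.exists_not_and_succ_of_not_zero_of_exists
      (p := fun k => (A ^ k) v ∈ P) (by simpa using hv) ⟨N, by simp [hN]⟩
    refine ⟨(A ^ k) v, hk, ?_⟩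
    simp only [Finset.forall_mem_insert]
    refine ⟨by simpa [pow_succ'] using hk', fun X hX => ?_⟩
    have h : X ((A ^ k) v) = (A ^ k) (X v) :=
      LinearMap.congr_fun ((((hcomm.2 X hX).1).pow_right k).eq) v
    rw [h]
    exact hinvpow k _ (hsv X hX)

variable {H E F : End ℂ V}

/-- Makes the space of vectors sent into `Q` by all of `W` stable under `A`. -/
theorem mem_of_lie_mem {W : Submodule ℂ (End ℂ V)} {Q : Submodule ℂ V} {A : End ℂ V}
    (hQ : ∀ v ∈ Q, A v ∈ Q) (hA : ∀ Y ∈ W, ⁅A, Y⁆ ∈ W) {v : V} (hv : ∀ Y ∈ W, Y v ∈ Q) :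
    ∀ Y ∈ W, Y (A v) ∈ Q := by
  intro Y hY
  have h : Y (A v) = A (Y v) - ⁅A, Y⁆ v := by simp [Ring.lie_def]
  rw [h]
  exact Q.sub_mem (hQ _ (hv Y hY)) (hv _ (hA Y hY))

theorem hasEigenvalue_of_pow_apply_eq_zero {c : ℂ} {v : V} (hv : v ≠ 0) {k : ℕ}
    (h : ((H - algebraMap ℂ (End ℂ V) c) ^ k) v = 0) : H.HasEigenvalue c := by
  refine End.hasEigenvalue_of_hasGenEigenvalue (k := k) ?_
  intro hbot
  exact hv ((Submodule.eq_bot_iff _).1 hbot v (End.mem_genEigenspace_nat.2 h))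

variable [FiniteDimensional ℂ V]

/-- Raising an eigenvector by `E` ends at a primitive vector of some weight `n ≥ c`, whose
`F`-string has `n + 1` independent members. -/
theorem exists_toNat_lt_finrank_of_hasEigenvalue (hHE : ⁅H, E⁆ = 2 • E) (hHF : ⁅H, F⁆ = -(2 • F))
    (hEF : ⁅E, F⁆ = H) {c : ℂ} (hc : H.HasEigenvalue c) :
    ∃ n : ℤ, c = n ∧ n.toNat < finrank ℂ V := by
  obtain ⟨v, hv⟩ := hc.exists_hasEigenvector
  have hv0 := hv.2
  have hV : Nontrivial V := ⟨v, 0, hv0⟩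
  -- `IsSl2Triple` requires `H ≠ 0`.
  by_cases hH : H = 0
  · have := hv.apply_eq_smul
    rw [hH, LinearMap.zero_apply, eq_comm, smul_eq_zero_iff_left hv0] at this
    exact ⟨0, by simpa using this, by simpa using finrank_pos⟩
  have t : IsSl2Triple H E F := ⟨hH, hEF, hHE, hHF⟩
  have hlie : ⁅H, v⁆ = c • v := hv.apply_eq_smul
  have hE : ∀ n : ℕ, ⁅H, ((LieModule.toEnd ℂ (End ℂ V) V E) ^ n) v⁆ =
      (c + 2 * n) • ((LieModule.toEnd ℂ (End ℂ V) V E) ^ n) v :=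
    fun n => t.lie_h_pow_toEnd_e hlie n
  have hex : ∃ n : ℕ, ((LieModule.toEnd ℂ (End ℂ V) V E) ^ n) v = 0 := by
    by_contra! hcon
    refine Set.infinite_range_of_injective (f := fun n : ℕ => c + 2 * (n : ℂ))
      (fun a b h => by simpa using h) ((End.finite_hasEigenvalue H).subset ?_)
    rintro _ ⟨n, rfl⟩
    exact End.hasEigenvalue_of_hasEigenvector ⟨End.mem_eigenspace_iff.2 (hE n), hcon n⟩
  obtain ⟨k, hk, hk'⟩ := Nat.exists_not_and_succ_of_not_zero_of_exists
    (p := fun k => ((LieModule.toEnd ℂ (End ℂ V) V E) ^ k) v = 0) (by simpa using hv0) hex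
  have P : t.HasPrimitiveVectorWith (((LieModule.toEnd ℂ (End ℂ V) V E) ^ k) v)
      (c + 2 * k) := ⟨hk, hE k, by rw [IsSl2Triple.lie_e_pow_toEnd_e]; exact hk'⟩
  obtain ⟨n, hn⟩ := P.exists_nat
  have hli : LinearIndependent ℂ (fun i : Fin (n + 1) =>
      ((LieModule.toEnd ℂ (End ℂ V) V F) ^ (i : ℕ))
        (((LieModule.toEnd ℂ (End ℂ V) V E) ^ k) v)) := by
    refine End.eigenvectors_linearIndependent' H (fun i : Fin (n + 1) => c + 2 * k - 2 * (i : ℕ))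
      (fun a b h => Fin.ext (by simpa using h)) _ fun i => ?_
    exact ⟨End.mem_eigenspace_iff.2 (P.lie_h_pow_toEnd_f i),
      P.pow_toEnd_f_ne_zero_of_eq_nat hn (Nat.lt_succ_iff.1 i.2)⟩
  have hle := hli.fintype_card_le_finrank
  rw [Fintype.card_fin] at hle
  refine ⟨n - 2 * k, ?_, by omega⟩
  push_cast
  rw [← hn]
  ring

/-- In a finite-dimensional representation of `sl₂`, the eigenvalues `n` of `H` are integers, and
`|n|` is smaller than the dimension. -/
theorem exists_natAbs_lt_finrank_of_hasEigenvalue (hHE : ⁅H, E⁆ = 2 • E)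
    (hHF : ⁅H, F⁆ = -(2 • F)) (hEF : ⁅E, F⁆ = H) {c : ℂ} (hc : H.HasEigenvalue c) :
    ∃ n : ℤ, c = n ∧ n.natAbs < finrank ℂ V := by
  obtain ⟨n, hn, hlt⟩ := exists_toNat_lt_finrank_of_hasEigenvalue hHE hHF hEF hc
  -- The opposite triple `-H, F, E` bounds the negative eigenvalues.
  obtain ⟨m, hm, hlt'⟩ := exists_toNat_lt_finrank_of_hasEigenvalue (H := -H) (E := F) (F := E)
    (c := -c) (by rw [neg_lie, hHF, neg_neg]) (by rw [neg_lie, hHE]) (by rw [← lie_skew, hEF])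
    (End.hasEigenvalue_neg_iff.2 (by simpa using hc))
  have hnm : m = -n := by
    have : (m : ℂ) = ((-n : ℤ) : ℂ) := by rw [← hm, hn]; simp
    exact_mod_cast this
  exact ⟨n, hn, by omega⟩

/-- An endomorphism that raises the eigenvalues of `H` by a nonzero amount is nilpotent. -/
theorem isNilpotent_of_lie_eq_smul {X : End ℂ V} {a : ℂ} (ha : a ≠ 0) (hX : ⁅H, X⁆ = a • X) :
    IsNilpotent X := by
  by_contra hcon
  -- Nonzero powers of `X` would give `ad H` infinitely many eigenvalues `n * a`.
  have hpow : ∀ n : ℕ, ⁅H, X ^ n⁆ = (n * a) • X ^ n := by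
    intro n
    induction n with
    | zero => simp [Ring.lie_def]
    | succ n ih =>
      have : ⁅H, X ^ (n + 1)⁆ = ⁅H, X ^ n⁆ * X + X ^ n * ⁅H, X⁆ := by
        simp only [Ring.lie_def, pow_succ]; noncomm_ring
      rw [this, ih, hX, smul_mul_assoc, mul_smul_comm, ← pow_succ, ← add_smul]
      congr 1
      push_cast
      ring
  refine Set.infinite_range_of_injective (f := fun n : ℕ => (n : ℂ) * a)
    (fun b c h => by simpa [ha] using h)
    ((End.finite_hasEigenvalue (LieAlgebra.ad ℂ (End ℂ V) H)).subset ?_)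
  rintro _ ⟨n, rfl⟩
  exact End.hasEigenvalue_of_hasEigenvector
    ⟨End.mem_eigenspace_iff.2 (hpow n), fun h => hcon ⟨n, h⟩⟩

/-- The eigenvalues of `H` on an invariant subspace and on the quotient. -/
theorem exists_natAbs_lt_finrank_of_invariant (hHE : ⁅H, E⁆ = 2 • E) (hHF : ⁅H, F⁆ = -(2 • F))
    (hEF : ⁅E, F⁆ = H) {U : Submodule ℂ V} (hH : ∀ v ∈ U, H v ∈ U) (hE : ∀ v ∈ U, E v ∈ U)
    (hF : ∀ v ∈ U, F v ∈ U) {c : ℂ} {v : V} {k : ℕ}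
    (h : ((H - algebraMap ℂ (End ℂ V) c) ^ k) v = 0) :
    (v ∈ U → v ≠ 0 → ∃ n : ℤ, c = n ∧ n.natAbs < finrank ℂ U) ∧
    (v ∉ U → ∃ n : ℤ, c = n ∧ n.natAbs < finrank ℂ (V ⧸ U)) := by
  constructor
  · intro hv hv0
    refine exists_natAbs_lt_finrank_of_hasEigenvalue (H := H.restrict hH) (E := E.restrict hE)
      (F := F.restrict hF) ?_ ?_ ?_ ?_
    · ext u
      exact LinearMap.congr_fun hHE u
    · ext u
      exact LinearMap.congr_fun hHF u
    · ext u
      exact LinearMap.congr_fun hEF u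
    · refine hasEigenvalue_of_pow_apply_eq_zero (v := ⟨v, hv⟩) (k := k) (by simpa using hv0) ?_
      have hj : ∀ j : ℕ, ((((H.restrict hH - algebraMap ℂ (End ℂ U) c) ^ j) ⟨v, hv⟩ : U) : V) =
          ((H - algebraMap ℂ (End ℂ V) c) ^ j) v := by
        intro j
        induction j with
        | zero => simp
        | succ j ih =>
          simp only [pow_succ', Module.End.mul_apply, LinearMap.sub_apply, Submodule.coe_sub,
            LinearMap.coe_restrict_apply, ih, Module.algebraMap_end_apply, Submodule.coe_smul]
      exact Subtype.ext ((hj k).trans h)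
  · intro hv
    refine exists_natAbs_lt_finrank_of_hasEigenvalue (H := U.mapQ U H hH) (E := U.mapQ U E hE)
      (F := U.mapQ U F hF) ?_ ?_ ?_ ?_
    · ext u
      exact congrArg U.mkQ (LinearMap.congr_fun hHE u)
    · ext u
      exact congrArg U.mkQ (LinearMap.congr_fun hHF u)
    · ext u
      exact congrArg U.mkQ (LinearMap.congr_fun hEF u)
    · refine hasEigenvalue_of_pow_apply_eq_zero (v := U.mkQ v) (k := k) (by simpa using hv) ?_
      have hj : ∀ j : ℕ, ((U.mapQ U H hH - algebraMap ℂ (End ℂ (V ⧸ U)) c) ^ j) (U.mkQ v) =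
          U.mkQ (((H - algebraMap ℂ (End ℂ V) c) ^ j) v) := by
        intro j
        induction j with
        | zero => simp
        | succ j ih =>
          rw [pow_succ', Module.End.mul_apply, ih, pow_succ', Module.End.mul_apply]
          rfl
      rw [hj, h, map_zero]

/-- In dimension at most `5`, a commuting space of endomorphisms that is stable under an
`sl₂`-triple and generated by an element `X` of weight `4` is zero. -/
theorem eq_zero_of_weight_four (hHE : ⁅H, E⁆ = 2 • E) (hHF : ⁅H, F⁆ = -(2 • F))
    (hEF : ⁅E, F⁆ = H) (hdim : finrank ℂ V ≤ 5) {W : Submodule ℂ (End ℂ V)}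
    (hW : ∀ X ∈ W, ∀ Y ∈ W, Commute X Y) (hWH : ∀ Y ∈ W, ⁅H, Y⁆ ∈ W)
    (hWE : ∀ Y ∈ W, ⁅E, Y⁆ ∈ W) (hWF : ∀ Y ∈ W, ⁅F, Y⁆ ∈ W) {X : End ℂ V} (hX : X ∈ W)
    (hHX : ⁅H, X⁆ = (4 : ℂ) • X)
    (hgen : ∀ W' ≤ W, X ∈ W' → (∀ Y ∈ W', ⁅F, Y⁆ ∈ W') → W ≤ W') : X = 0 := by
  by_contra hX0
  have : IsAddTorsionFree (End ℂ V) := .of_isTorsionFree ℂ _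
  -- The nilpotent elements of the commuting space `W` form an `F`-stable subspace containing `X`.
  have hnil : ∀ Y ∈ W, IsNilpotent Y := by
    let N : Submodule ℂ (End ℂ V) :=
      { carrier := {Y | Y ∈ W ∧ IsNilpotent Y}
        zero_mem' := ⟨W.zero_mem, IsNilpotent.zero⟩
        add_mem' := fun ha hb => ⟨W.add_mem ha.1 hb.1,
          (hW _ ha.1 _ hb.1).isNilpotent_add ha.2 hb.2⟩
        smul_mem' := fun c Y hY => ⟨W.smul_mem c hY.1, hY.2.smul c⟩ }
    have hN : W ≤ N := hgen N (fun Y hY => hY.1)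
      ⟨hX, isNilpotent_of_lie_eq_smul (by norm_num) hHX⟩ fun Y hY => ⟨hWF Y hY.1,
        isNilpotent_commutator (d := F) rfl rfl (hW _ hY.1 _ (hWF _ hY.1))
          (hW _ (hWF _ hY.1) _ (hWF _ (hWF _ hY.1))) hY.2⟩
    exact fun Y hY => (hN hY).2
  -- `pre ⊥` is the common kernel `U` of `W`, and `pre U` is the next step of the filtration.
  let pre (Q : Submodule ℂ V) : Submodule ℂ V :=
    { carrier := {v | ∀ Y ∈ W, Y v ∈ Q}
      zero_mem' := fun Y _ => by simp
      add_mem' := fun ha hb Y hY => by rw [map_add]; exact Q.add_mem (ha Y hY) (hb Y hY)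
      smul_mem' := fun c v hv Y hY => by rw [map_smul]; exact Q.smul_mem c (hv Y hY) }
  have hpre : ∀ {A : End ℂ V}, (∀ Y ∈ W, ⁅A, Y⁆ ∈ W) → ∀ {Q : Submodule ℂ V},
      (∀ v ∈ Q, A v ∈ Q) → ∀ v ∈ pre Q, A v ∈ pre Q :=
    fun hA _ hQ v hv => mem_of_lie_mem hQ hA hv
  have hbot : ∀ (A : End ℂ V), ∀ v ∈ (⊥ : Submodule ℂ V), A v ∈ (⊥ : Submodule ℂ V) := by
    intro A v hv
    rw [Submodule.mem_bot] at hv ⊢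
    rw [hv, map_zero]
  set U := pre ⊥
  have hUH := hpre hWH (hbot H)
  have hUE := hpre hWE (hbot E)
  have hUF := hpre hWF (hbot F)
  have hUtop : U ≠ ⊤ := by
    intro htop
    refine hX0 (LinearMap.ext fun v => ?_)
    have hv : v ∈ U := htop ▸ Submodule.mem_top
    exact hv X hX
  obtain ⟨v, hvU, hv⟩ : ∃ v ∉ U, v ∈ pre U := by
    obtain ⟨s, hs⟩ : W.FG := IsNoetherian.noetherian W
    have hsW : ∀ Y ∈ s, Y ∈ W := fun Y hY => hs ▸ Submodule.subset_span hY
    obtain ⟨v, hvU, hv⟩ := exists_notMem_forall_apply_mem hUtop s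
      (fun X hX Y hY => hW _ (hsW X hX) _ (hsW Y hY)) (fun Y hY => hnil _ (hsW Y hY))
      (fun Y hY u hu => by
        have : Y u = 0 := hu Y (hsW Y hY)
        rw [this]
        exact U.zero_mem)
    refine ⟨v, hvU, fun Y hY => ?_⟩
    rw [← hs] at hY
    have : Submodule.span ℂ (s : Set (End ℂ V)) ≤ U.comap (LinearMap.applyₗ v) :=
      Submodule.span_le.2 fun Y hY => hv Y hY
    exact this hY
  have hPH := hpre hWH hUH
  have hPF := hpre hWF hUF
  -- The elements of `W` killing `pre U` form an `F`-stable subspace. If `X` were among them, all of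
  -- `W` would kill `pre U`, contradicting `v ∉ U`.
  have hXP : ∃ u ∈ pre U, X u ≠ 0 := by
    by_contra! hcon
    let W' : Submodule ℂ (End ℂ V) :=
      { carrier := {Y | Y ∈ W ∧ ∀ u ∈ pre U, Y u = 0}
        zero_mem' := ⟨W.zero_mem, fun _ _ => rfl⟩
        add_mem' := fun ha hb => ⟨W.add_mem ha.1 hb.1, fun u hu => by
          rw [LinearMap.add_apply, ha.2 u hu, hb.2 u hu, add_zero]⟩
        smul_mem' := fun c Y hY => ⟨W.smul_mem c hY.1, fun u hu => by
          rw [LinearMap.smul_apply, hY.2 u hu, smul_zero]⟩ }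
    have hW' : W ≤ W' := hgen W' (fun Y hY => hY.1) ⟨hX, hcon⟩ fun Y hY =>
      ⟨hWF Y hY.1, fun u hu => by
        simp [Ring.lie_def, hY.2 u hu, hY.2 _ (hPF u hu)]⟩
    exact hvU fun Y hY => (hW' hY).2 v hv
  -- Generalized eigenvectors span `pre U`, so one of them is not killed by `X`; diagonalizability
  -- of `H` is not needed.
  obtain ⟨c, k, w, hwP, hwX, hw⟩ : ∃ (c : ℂ) (k : ℕ) (w : V), w ∈ pre U ∧ X w ≠ 0 ∧
      ((H - algebraMap ℂ (End ℂ V) c) ^ k) w = 0 := by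
    by_contra! hcon
    obtain ⟨u, hu, hXu⟩ := hXP
    refine hXu ?_
    have htop := End.iSup_maxGenEigenspace_eq_top (H.restrict hPH)
    have hle : (⨆ c : ℂ, End.maxGenEigenspace (H.restrict hPH) c) ≤
        LinearMap.ker (X.domRestrict (pre U)) := by
      refine iSup_le fun c w hw => ?_
      obtain ⟨k, hk⟩ := End.mem_maxGenEigenspace _ _ _ |>.1 hw
      by_contra hne
      refine hcon c k w w.2 hne ?_
      have hj : ∀ j : ℕ, ((((H.restrict hPH - c • (1 : End ℂ (pre U))) ^ j) w : pre U) : V) =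
          ((H - algebraMap ℂ (End ℂ V) c) ^ j) w := by
        intro j
        induction j with
        | zero => simp
        | succ j ih =>
          simp only [pow_succ', Module.End.mul_apply, LinearMap.sub_apply, Submodule.coe_sub,
            LinearMap.coe_restrict_apply, ih, Module.algebraMap_end_apply, Submodule.coe_smul,
            LinearMap.smul_apply, Module.End.one_apply]
      rw [← hj, hk]
      rfl
    rw [htop] at hle
    exact hle (Submodule.mem_top (x := ⟨u, hu⟩))
  have hwU : w ∉ U := fun h => hwX (h X hX)
  -- `X` intertwines `H - c` with `H - (c + 4)`.
  have hXw : ((H - algebraMap ℂ (End ℂ V) (c + 4)) ^ k) (X w) = 0 := by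
    have hc : SemiconjBy X (H - algebraMap ℂ (End ℂ V) c) (H - algebraMap ℂ (End ℂ V) (c + 4)) := by
      rw [Ring.lie_def, sub_eq_iff_eq_add] at hHX
      rw [SemiconjBy, sub_mul, hHX, map_add, add_mul, mul_sub, Algebra.commutes c X,
        Algebra.algebraMap_eq_smul_one (4 : ℂ), smul_mul_assoc, one_mul]
      abel
    have := LinearMap.congr_fun (hc.pow_right k).eq w
    rw [Module.End.mul_apply, hw, map_zero] at this
    exact this.symm
  obtain ⟨n, hn, hlt⟩ :=
    (exists_natAbs_lt_finrank_of_invariant (U := U) hHE hHF hEF hUH hUE hUF hw).2 hwU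
  obtain ⟨m, hm, hlt'⟩ :=
    (exists_natAbs_lt_finrank_of_invariant (U := U) hHE hHF hEF hUH hUE hUF hXw).1 (hwP X hX) hwX
  have hmn : m = n + 4 := by
    have : (m : ℂ) = ((n + 4 : ℤ) : ℂ) := by rw [← hm, hn]; simp
    exact_mod_cast this
  -- The two strict bounds give `|n| + |n + 4| ≤ 5 - 2 = 3`, but the left side is at least `4`.
  have := U.finrank_quotient_add_finrank
  omega

end Modules

/-! ### Commuting families with a standard weight basis. -/

open Module

theorem mem_span_range_of_forall {V ι : Type*} [AddCommGroup V] [Module ℂ V] {A : End ℂ V}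
    {x : ι → End ℂ V} (h : ∀ i, ⁅A, x i⁆ ∈ Submodule.span ℂ (Set.range x)) :
    ∀ Y ∈ Submodule.span ℂ (Set.range x), ⁅A, Y⁆ ∈ Submodule.span ℂ (Set.range x) := by
  have : Submodule.span ℂ (Set.range x) ≤
      (Submodule.span ℂ (Set.range x)).comap (LieAlgebra.ad ℂ (End ℂ V) A) :=
    Submodule.span_le.2 (by rintro _ ⟨i, rfl⟩; exact h i)
  exact fun Y hY => this hY

theorem commute_of_mem_span {V ι : Type*} [AddCommGroup V] [Module ℂ V] {x : ι → End ℂ V}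
    (hcomm : ∀ i j, Commute (x i) (x j)) {X Y : End ℂ V}
    (hX : X ∈ Submodule.span ℂ (Set.range x)) (hY : Y ∈ Submodule.span ℂ (Set.range x)) :
    Commute X Y := by
  have h1 : ∀ i, Commute (x i) Y := by
    intro i
    induction hY using Submodule.span_induction with
    | mem Y hY => obtain ⟨j, rfl⟩ := hY; exact hcomm i j
    | zero => exact Commute.zero_right _
    | add _ _ _ _ h h' => exact h.add_right h'
    | smul c _ _ h => exact h.smul_right c
  induction hX using Submodule.span_induction with
  | mem X hX => obtain ⟨j, rfl⟩ := hX; exact h1 j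
  | zero => exact Commute.zero_left _
  | add _ _ _ _ h h' => exact h.add_left h'
  | smul c _ _ h => exact h.smul_left c

/-- In dimension at most `5`, there is no commuting family of endomorphisms on which an
`sl₂`-triple acts as on the standard basis of the irreducible representation of dimension `5`. -/
theorem eq_zero_of_commuting_basis {V : Type*} [AddCommGroup V] [Module ℂ V]
    [FiniteDimensional ℂ V] {H E F : End ℂ V} (hdim : finrank ℂ V ≤ 5)
    (hHE : ⁅H, E⁆ = 2 • E) (hHF : ⁅H, F⁆ = -(2 • F)) (hEF : ⁅E, F⁆ = H) {x : Fin 5 → End ℂ V}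
    (hcomm : ∀ i j, Commute (x i) (x j))
    (hH : ∀ i, ⁅H, x i⁆ = (![4, 2, 0, -2, -4] i : ℂ) • x i)
    (hE : ∀ i : Fin 5, ⁅E, x i⁆ = ![0, (4 : ℂ) • x 0, (3 : ℂ) • x 1, (2 : ℂ) • x 2, x 3] i)
    (hF : ∀ i : Fin 5, ⁅F, x i⁆ =
      ![x 1, (2 : ℂ) • x 2, (3 : ℂ) • x 3, (4 : ℂ) • x 4, 0] i) : x 0 = 0 := by
  have hx : ∀ i, x i ∈ Submodule.span ℂ (Set.range x) := fun i => Submodule.subset_span ⟨i, rfl⟩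
  refine eq_zero_of_weight_four hHE hHF hEF hdim (W := Submodule.span ℂ (Set.range x)) ?_
    (mem_span_range_of_forall fun i => ?_) (mem_span_range_of_forall fun i => ?_)
    (mem_span_range_of_forall fun i => ?_) (hx 0) (by simpa using hH 0) ?_
  · exact fun X hX Y hY => commute_of_mem_span hcomm hX hY
  · rw [hH]
    exact Submodule.smul_mem _ _ (hx i)
  · rw [hE]
    fin_cases i
    · exact Submodule.zero_mem _
    · exact Submodule.smul_mem _ _ (hx 0)
    · exact Submodule.smul_mem _ _ (hx 1)
    · exact Submodule.smul_mem _ _ (hx 2)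
    · exact hx 3
  · rw [hF]
    fin_cases i
    · exact hx 1
    · exact Submodule.smul_mem _ _ (hx 2)
    · exact Submodule.smul_mem _ _ (hx 3)
    · exact Submodule.smul_mem _ _ (hx 4)
    · exact Submodule.zero_mem _
  · intro W' _ h0 hW'
    have hstep : ∀ {i j : Fin 5} {c : ℂ}, c ≠ 0 → ⁅F, x i⁆ = c • x j → x i ∈ W' → x j ∈ W' := by
      intro i j c hc h hi
      have := hW' _ hi
      rw [h] at this
      exact (W'.smul_mem_iff hc).1 this
    have h1 : x 1 ∈ W' := hstep one_ne_zero (by simpa using hF 0) h0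
    have h2 : x 2 ∈ W' := hstep two_ne_zero (hF 1) h1
    have h3 : x 3 ∈ W' := hstep three_ne_zero (hF 2) h2
    have h4 : x 4 ∈ W' := hstep (by norm_num) (hF 3) h3
    refine Submodule.span_le.2 ?_
    rintro _ ⟨i, rfl⟩
    fin_cases i <;> assumption

/-! ### Complexification of a commuting copy. -/

/-- Real matrices as endomorphisms of `ℂⁿ`. -/
noncomputable def complexifyMatrix (n : ℕ) :
    Matrix (Fin n) (Fin n) ℝ →ₐ[ℝ] End ℂ (Fin n → ℂ) :=
  ((Matrix.toLinAlgEquiv' (R := ℂ) (n := Fin n)).restrictScalars ℝ).toAlgHom.comp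
    Complex.ofRealAm.mapMatrix

theorem complexifyMatrix_apply_single {n : ℕ} (M : Matrix (Fin n) (Fin n) ℝ) (i j : Fin n) :
    complexifyMatrix n M (Pi.single j 1) i = M i j := by
  simp [complexifyMatrix]

variable {L : Type*} [LieRing L] [LieAlgebra ℝ L]

theorem HasCommutingCopy.exists_complexification {N n : ℕ} {φ : MatRep L N} {ρ : MatRep L n}
    (h : HasCommutingCopy φ ρ) :
    ∃ (Φ : L →ₗ⁅ℝ⁆ End ℂ (Fin N → ℂ)) (m : Fin n → End ℂ (Fin N → ℂ)),
      (∀ A j, ⁅Φ A, m j⁆ = ∑ i, (ρ A i j : ℂ) • m i) ∧ (∀ i j, Commute (m i) (m j)) ∧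
      LinearIndependent ℂ m := by
  obtain ⟨W, -, hcomm, e, he⟩ := h
  let M (j : Fin n) : Matrix (Fin N) (Fin N) ℝ := e (Pi.single j 1)
  have hM : ∀ v : Fin n → ℝ, (e v : Matrix (Fin N) (Fin N) ℝ) = ∑ i, v i • M i := by
    intro v
    conv_lhs => rw [pi_eq_sum_univ' v]
    simp only [map_sum, map_smul, Submodule.coe_sum, Submodule.coe_smul]
    rfl
  refine ⟨(complexifyMatrix N).toLieHom.comp φ, fun j => complexifyMatrix N (M j), ?_, ?_, ?_⟩
  · intro A j
    have h1 : ⁅φ A, M j⁆ = ∑ i, ρ A i j • M i := by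
      rw [← he A (Pi.single j 1), hM]
      simp
    have h2 := congrArg (complexifyMatrix N) h1
    rw [map_sum] at h2
    simp only [map_smul] at h2
    calc _ = complexifyMatrix N ⁅φ A, M j⁆ := by
          rw [Ring.lie_def, Ring.lie_def, map_sub, map_mul, map_mul]; rfl
      _ = _ := h2
  · intro i j
    have h1 : M i * M j = M j * M i := sub_eq_zero.1 (hcomm _ (e _).2 _ (e _).2)
    rw [Commute, SemiconjBy, ← map_mul, h1, map_mul]
  -- The matrices `M i` have real entries, so a complex relation splits into two real ones, each
  -- trivial because `e` is injective.
  · have hreal : ∀ r : Fin n → ℝ, (∀ a b, ∑ i, r i * M i a b = 0) → r = 0 := by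
      intro r hr
      refine e.map_eq_zero_iff.1 (Subtype.ext ?_)
      rw [hM]
      ext a b
      simpa [Matrix.sum_apply] using hr a b
    rw [Fintype.linearIndependent_iff]
    intro g hg
    have hentry : ∀ a b, ∑ i, g i * (M i a b : ℂ) = 0 := by
      intro a b
      have := congrFun (LinearMap.congr_fun hg (Pi.single b 1)) a
      simpa [LinearMap.sum_apply, complexifyMatrix_apply_single] using this
    have hre := hreal (fun i => (g i).re) fun a b => by
      simpa using congrArg Complex.re (hentry a b)
    have him := hreal (fun i => (g i).im) fun a b => by
      simpa using congrArg Complex.im (hentry a b)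
    exact fun i => Complex.ext (congrFun hre i) (congrFun him i)

/-! ### The case of `sl(2, ℝ)`. -/

/-- The element of `sl(2, ℝ)` with rows `(a, b)` and `(c, -a)`. -/
def sl2Mk (a b c : ℝ) : sl2 :=
  ⟨!![a, b; c, -a], show Matrix.trace !![a, b; c, -a] = 0 by simp [Matrix.trace_fin_two]⟩

theorem D2_sl2Mk (a b c : ℝ) : D2 (sl2Mk a b c) = D2Matrix a b c := rfl

/-- The basis of `D2Matrix` is already the standard weight basis. All `n ≤ 5` are covered because
computing `mu` must exclude every smaller size. -/
theorem not_hasCommutingCopy_D2 {n : ℕ} (hn : n ≤ 5) (φ : MatRep sl2 n) :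
    ¬ HasCommutingCopy φ D2 := by
  intro h
  obtain ⟨Φ, m, hact, hcomm, hli⟩ := h.exists_complexification
  have hHE : ⁅sl2Mk 1 0 0, sl2Mk 0 1 0⁆ = (2 : ℝ) • sl2Mk 0 1 0 := by
    apply Subtype.ext
    change _ * _ - _ * _ = (2 : ℝ) • _
    ext i j
    fin_cases i <;> fin_cases j <;> simp [sl2Mk] <;> norm_num
  have hHF : ⁅sl2Mk 1 0 0, sl2Mk 0 0 1⁆ = (-2 : ℝ) • sl2Mk 0 0 1 := by
    apply Subtype.ext
    change _ * _ - _ * _ = (-2 : ℝ) • _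
    ext i j
    fin_cases i <;> fin_cases j <;> simp [sl2Mk] <;> norm_num
  have hEF : ⁅sl2Mk 0 1 0, sl2Mk 0 0 1⁆ = sl2Mk 1 0 0 := by
    apply Subtype.ext
    change _ * _ - _ * _ = _
    ext i j
    fin_cases i <;> fin_cases j <;> simp [sl2Mk]
  refine hli.ne_zero 0 (eq_zero_of_commuting_basis (H := Φ (sl2Mk 1 0 0)) (E := Φ (sl2Mk 0 1 0))
    (F := Φ (sl2Mk 0 0 1)) (by simpa using hn) ?_ ?_ ?_ hcomm ?_ ?_ ?_)
  · rw [← LieHom.map_lie, hHE, map_smul, two_smul, two_smul]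
  · rw [← LieHom.map_lie, hHF, map_smul]
    module
  · rw [← LieHom.map_lie, hEF]
  all_goals
    intro i
    rw [hact, D2_sl2Mk]
    fin_cases i <;> simp [D2Matrix, Fin.sum_univ_five]

/-! ### The case of `so(3)`, which becomes `sl₂` over `ℂ`. -/

/-- The element of `so(3)` with `A₁₂ = 2 a`, `A₂₀ = 2 b` and `A₀₁ = c`. -/
def so3Mk (a b c : ℝ) : so3 :=
  ⟨!![0, c, -(2 * b); -c, 0, 2 * a; 2 * b, -(2 * a), 0], by
    rw [LieAlgebra.Orthogonal.mem_so]
    ext i j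
    fin_cases i <;> fin_cases j <;> simp⟩

theorem R5_so3Mk (a b c : ℝ) : R5 (so3Mk a b c) = R5Matrix a b c := by
  change R5Matrix (2 * a / 2) (2 * b / 2) c = _
  congr 1 <;> ring

theorem real_smul_end_eq {n : ℕ} (r : ℝ) (X : End ℂ (Fin n → ℂ)) : r • X = (r : ℂ) • X := by
  refine LinearMap.ext fun v => funext fun i => ?_
  simp

/-- The complex Lie algebra `so(3)`, spanned by `P`, `Q`, `R`, and its action by the matrices
`R5Matrix` on the span of `m`, in terms of an `sl₂`-triple and a basis of weight vectors. -/
theorem exists_sl2_basis {𝔤 : Type*} [LieRing 𝔤] [LieAlgebra ℂ 𝔤] {P Q R : 𝔤} {m : Fin 5 → 𝔤}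
    (hPQ : ⁅P, Q⁆ = (-4 : ℂ) • R) (hQR : ⁅Q, R⁆ = (-1 : ℂ) • P) (hRP : ⁅R, P⁆ = (-1 : ℂ) • Q)
    (hP : ∀ j, ⁅P, m j⁆ = ![(-1 : ℂ) • m 3, m 2, (-4 : ℂ) • m 1 + (2 : ℂ) • m 4, (4 : ℂ) • m 0,
      (-6 : ℂ) • m 2] j)
    (hQ : ∀ j, ⁅Q, m j⁆ = ![(-1 : ℂ) • m 2, (-1 : ℂ) • m 3, (4 : ℂ) • m 0,
      (4 : ℂ) • m 1 + (2 : ℂ) • m 4, (-6 : ℂ) • m 3] j)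
    (hR : ∀ j, ⁅R, m j⁆ = ![(-2 : ℂ) • m 1, (2 : ℂ) • m 0, (-1 : ℂ) • m 3, m 2, 0] j) :
    ∃ (H E F : 𝔤) (x : Fin 5 → 𝔤), ⁅H, E⁆ = 2 • E ∧ ⁅H, F⁆ = -(2 • F) ∧ ⁅E, F⁆ = H ∧
      x 0 = m 0 + Complex.I • m 1 ∧ (∀ i, x i ∈ Submodule.span ℂ (Set.range m)) ∧
      (∀ i, ⁅H, x i⁆ = (![4, 2, 0, -2, -4] i : ℂ) • x i) ∧
      (∀ i : Fin 5, ⁅E, x i⁆ = ![0, (4 : ℂ) • x 0, (3 : ℂ) • x 1, (2 : ℂ) • x 2, x 3] i) ∧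
      (∀ i : Fin 5, ⁅F, x i⁆ =
        ![x 1, (2 : ℂ) • x 2, (3 : ℂ) • x 3, (4 : ℂ) • x 4, 0] i) := by
  -- The imaginary unit becomes an atom known only through `I ^ 2 = -1`.
  obtain ⟨I, hI, hII⟩ : ∃ I : ℂ, I = Complex.I ∧ I ^ 2 = -1 := ⟨_, rfl, Complex.I_sq⟩
  have hQP : ⁅Q, P⁆ = (4 : ℂ) • R := by rw [← lie_skew, hPQ]; module
  have hRQ : ⁅R, Q⁆ = P := by rw [← lie_skew, hQR]; module
  have hP0 := hP 0
  have hP1 := hP 1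
  have hP2 := hP 2
  have hP3 := hP 3
  have hP4 := hP 4
  have hQ0 := hQ 0
  have hQ1 := hQ 1
  have hQ2 := hQ 2
  have hQ3 := hQ 3
  have hQ4 := hQ 4
  have hR0 := hR 0
  have hR1 := hR 1
  have hR2 := hR 2
  have hR3 := hR 3
  have hR4 := hR 4
  simp only [Matrix.cons_val] at hP0 hP1 hP2 hP3 hP4 hQ0 hQ1 hQ2 hQ3 hQ4 hR0 hR1 hR2 hR3 hR4
  have hm : ∀ i, m i ∈ Submodule.span ℂ (Set.range m) := fun i => Submodule.subset_span ⟨i, rfl⟩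
  -- `R` acts on `m 0 + I • m 1` by `2 * I`, so `H = -2 * I • R` gives it weight `4`. `E` and `F`
  -- are eigenvectors of `ad H` scaled so that `[E, F] = H`, and the `k`-th vector is `F ^ k`
  -- applied to the first, divided by `k!`.
  refine ⟨(-2 * I) • R, P + I • Q, (-1 / 4 : ℂ) • P + (I / 4) • Q,
    ![m 0 + I • m 1, (1 / 2 : ℂ) • m 3 + (-I / 2) • m 2,
    (I / 4) • m 4, (1 / 8 : ℂ) • m 3 + (I / 8) • m 2, (-1 / 16 : ℂ) • m 0 + (I / 16) • m 1],
    ?_, ?_, ?_, by rw [hI]; rfl, ?_, ?_, ?_, ?_⟩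
  · simp only [lie_add, smul_lie, lie_smul, hRP, hRQ]
    match_scalars
    · ring
    · linear_combination (-2 : ℂ) * hII
  · simp only [lie_add, smul_lie, lie_smul, hRP, hRQ]
    match_scalars
    · ring
    · linear_combination (-1 / 2 : ℂ) * hII
  · simp only [lie_add, add_lie, smul_lie, lie_smul, hPQ, hQP, lie_self]
    match_scalars <;> ring
  · intro i
    fin_cases i
    · exact add_mem (hm 0) (Submodule.smul_mem _ _ (hm 1))
    · exact add_mem (Submodule.smul_mem _ _ (hm 3)) (Submodule.smul_mem _ _ (hm 2))
    · exact Submodule.smul_mem _ _ (hm 4)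
    · exact add_mem (Submodule.smul_mem _ _ (hm 3)) (Submodule.smul_mem _ _ (hm 2))
    · exact add_mem (Submodule.smul_mem _ _ (hm 0)) (Submodule.smul_mem _ _ (hm 1))
  all_goals
    intro i
    fin_cases i <;>
    simp only [Fin.mk_zero, Fin.mk_one, Fin.reduceFinMk, Matrix.cons_val, lie_add,
      add_lie, smul_lie, lie_smul, hP0, hP1, hP2, hP3, hP4, hQ0, hQ1, hQ2, hQ3, hQ4, hR0, hR1, hR2,
      hR3, hR4] <;>
    match_scalars <;> ring_nf <;> simp only [hII] <;> norm_num

theorem not_hasCommutingCopy_R5 {n : ℕ} (hn : n ≤ 5) (φ : MatRep so3 n) :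
    ¬ HasCommutingCopy φ R5 := by
  intro h
  obtain ⟨Φ, m, hact, hcomm, hli⟩ := h.exists_complexification
  have hab : ⁅so3Mk 1 0 0, so3Mk 0 1 0⁆ = (-4 : ℝ) • so3Mk 0 0 1 := by
    apply Subtype.ext
    change _ * _ - _ * _ = (-4 : ℝ) • _
    ext i j
    fin_cases i <;> fin_cases j <;> simp [so3Mk] <;> norm_num
  have hbc : ⁅so3Mk 0 1 0, so3Mk 0 0 1⁆ = (-1 : ℝ) • so3Mk 1 0 0 := by
    apply Subtype.ext
    change _ * _ - _ * _ = (-1 : ℝ) • _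
    ext i j
    fin_cases i <;> fin_cases j <;> simp [so3Mk]
  have hca : ⁅so3Mk 0 0 1, so3Mk 1 0 0⁆ = (-1 : ℝ) • so3Mk 0 1 0 := by
    apply Subtype.ext
    change _ * _ - _ * _ = (-1 : ℝ) • _
    ext i j
    fin_cases i <;> fin_cases j <;> simp [so3Mk]
  obtain ⟨H, E, F, x, hHE, hHF, hEF, hx0, hx, hH, hE, hF⟩ :=
    exists_sl2_basis (P := Φ (so3Mk 1 0 0)) (Q := Φ (so3Mk 0 1 0)) (R := Φ (so3Mk 0 0 1)) (m := m)
      (by rw [← LieHom.map_lie, hab, map_smul, real_smul_end_eq]; push_cast; rfl)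
      (by rw [← LieHom.map_lie, hbc, map_smul, real_smul_end_eq]; push_cast; rfl)
      (by rw [← LieHom.map_lie, hca, map_smul, real_smul_end_eq]; push_cast; rfl)
      (fun j => by
        rw [hact, R5_so3Mk]
        fin_cases j <;> simp [R5Matrix, Fin.sum_univ_five] <;> module)
      (fun j => by
        rw [hact, R5_so3Mk]
        fin_cases j <;> simp [R5Matrix, Fin.sum_univ_five] <;> module)
      (fun j => by
        rw [hact, R5_so3Mk]
        fin_cases j <;> simp [R5Matrix, Fin.sum_univ_five] <;> module)
  have hx00 := eq_zero_of_commuting_basis (by simpa using hn) hHE hHF hEF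
    (fun i j => commute_of_mem_span hcomm (hx i) (hx j)) hH hE hF
  -- `x 0 = 0` is a relation among the independent `m i` whose coefficient at `m 0` is `1`.
  have h01 := Fintype.linearIndependent_iff.1 hli ![1, Complex.I, 0, 0, 0]
    (by rw [hx0] at hx00; simpa [Fin.sum_univ_five] using hx00) 0
  simp at h01

/-! ### Faithful representations of semidirect products. -/

/-- The matrix of the affine map with linear part `M` and translation part `v`. -/
def affineMatrix {n : ℕ} (M : Matrix (Fin n) (Fin n) ℝ) (v : Fin n → ℝ) :
    Matrix (Fin n ⊕ Fin 1) (Fin n ⊕ Fin 1) ℝ :=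
  fromBlocks M (replicateCol (Fin 1) v) 0 0

theorem affineMatrix_lie {n : ℕ} (M M' : Matrix (Fin n) (Fin n) ℝ) (v v' : Fin n → ℝ) :
    ⁅affineMatrix M v, affineMatrix M' v'⁆ = affineMatrix ⁅M, M'⁆ (M *ᵥ v' - M' *ᵥ v) := by
  simp only [affineMatrix, Ring.lie_def, fromBlocks_multiply, Matrix.mul_zero, Matrix.zero_mul,
    add_zero, ← replicateCol_mulVec]
  ext (i | i) (j | j) <;> simp

/-- The affine representation of the semidirect product. -/
noncomputable def affineRep {n : ℕ} (ρ : MatRep L n) : MatRep (SemidirectByRep ρ) (n + 1) :=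
  (Matrix.reindexLieEquiv (R := ℝ) finSumFinEquiv).toLieHom.comp
    { toFun := fun x => affineMatrix (ρ x.right) x.left
      map_add' := fun x y => by
        ext (i | i) (j | j) <;> simp [affineMatrix]
      map_smul' := fun c x => by
        ext (i | i) (j | j) <;> simp [affineMatrix]
      map_lie' := fun {x y} => by
        rw [affineMatrix_lie, semidirect_lie, LieHom.map_lie] }

theorem hasFaithfulRep_semidirect {n : ℕ} {ρ : MatRep L n} (hρ : Function.Injective ρ) :
    HasFaithfulRep (SemidirectByRep ρ) (n + 1) := by
  refine ⟨affineRep ρ, ((Matrix.reindexLieEquiv (R := ℝ) finSumFinEquiv).injective).comp ?_⟩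
  rintro ⟨v, A⟩ ⟨w, B⟩ h
  have h' : affineMatrix (ρ A) v = affineMatrix (ρ B) w := h
  obtain ⟨h1, h2, -, -⟩ := fromBlocks_inj.1 h'
  rw [hρ h1, replicateCol_injective h2]

/-- The copy is the image of the abelian ideal. The bracket of the semidirect product turns `ρ A *ᵥ
v` into a commutator, and faithfulness makes the equivalence. -/
theorem HasFaithfulRep.exists_hasCommutingCopy {n N : ℕ} {ρ : MatRep L n}
    (h : HasFaithfulRep (SemidirectByRep ρ) N) : ∃ φ : MatRep L N, HasCommutingCopy φ ρ := by
  obtain ⟨Φ, hΦ⟩ := h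
  let inl := LieAlgebra.SemiDirectSum.inl (derivOfRep ρ)
  let inr := LieAlgebra.SemiDirectSum.inr (derivOfRep ρ)
  have hlie : ∀ A v, Φ (inl (ρ A *ᵥ v)) = ⁅Φ (inr A), Φ (inl v)⁆ := by
    intro A v
    rw [← LieHom.map_lie, semidirect_lie]
    simp [inl, inr]
  let f : (Fin n → ℝ) →ₗ[ℝ] Matrix (Fin N) (Fin N) ℝ := (Φ.comp inl).toLinearMap
  have hf : Function.Injective f :=
    hΦ.comp (LieAlgebra.SemiDirectSum.inl_injective (derivOfRep ρ))
  refine ⟨Φ.comp inr, LinearMap.range f, ?_, ?_, LinearEquiv.ofInjective f hf, hlie⟩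
  · rintro A _ ⟨v, rfl⟩
    exact ⟨ρ A *ᵥ v, hlie A v⟩
  · rintro _ ⟨v, rfl⟩ _ ⟨w, rfl⟩
    change ⁅(Φ.comp inl) v, (Φ.comp inl) w⁆ = 0
    rw [← LieHom.map_lie, lie_pi_eq_zero, map_zero]

theorem mu_semidirect_eq {n : ℕ} {ρ : MatRep L n} (hρ : Function.Injective ρ)
    (h : ∀ N ≤ n, ∀ φ : MatRep L N, ¬ HasCommutingCopy φ ρ) :
    mu (SemidirectByRep ρ) = n + 1 := by
  refine le_antisymm (Nat.sInf_le (hasFaithfulRep_semidirect hρ)) ?_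
  by_contra! hlt
  -- The affine representation makes the set nonempty, so the infimum is attained and is not the
  -- default `0`.
  obtain ⟨φ, hφ⟩ := HasFaithfulRep.exists_hasCommutingCopy
    (Nat.sInf_mem (s := {N | HasFaithfulRep (SemidirectByRep ρ) N})
      ⟨n + 1, hasFaithfulRep_semidirect hρ⟩)
  exact h _ (Nat.lt_succ_iff.1 hlt) φ hφ

theorem R5_injective : Function.Injective R5 := by
  refine (injective_iff_map_eq_zero R5).2 fun A hA => ?_
  have hA' : R5Matrix (A.1 1 2 / 2) (A.1 2 0 / 2) (A.1 0 1) = 0 := hA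
  have h12 : A.1 1 2 = 0 := by simpa [R5Matrix] using congrFun (congrFun hA' 2) 1
  have h20 : A.1 2 0 = 0 := by simpa [R5Matrix] using congrFun (congrFun hA' 2) 0
  have h01 : A.1 0 1 = 0 := by simpa [R5Matrix] using congrFun (congrFun hA' 2) 3
  have hd : ∀ i, A.1 i i = 0 := fun i => by linarith [so3_apply A i i]
  apply Subtype.ext
  ext i j
  fin_cases i <;> fin_cases j <;>
    simp [hd, h12, h20, h01, so3_apply A 2 1, so3_apply A 0 2, so3_apply A 1 0]

theorem D2_injective : Function.Injective D2 := by
  refine (injective_iff_map_eq_zero D2).2 fun A hA => ?_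
  have hA' : D2Matrix (A.1 0 0) (A.1 0 1) (A.1 1 0) = 0 := hA
  have h00 : A.1 0 0 = 0 := by simpa [D2Matrix] using congrFun (congrFun hA' 0) 0
  have h01 : A.1 0 1 = 0 := by simpa [D2Matrix] using congrFun (congrFun hA' 0) 1
  have h10 : A.1 1 0 = 0 := by simpa [D2Matrix] using congrFun (congrFun hA' 1) 0
  apply Subtype.ext
  ext i j
  fin_cases i <;> fin_cases j <;> simp [h00, h01, h10, sl2_apply A]

end LeviRep

theorem mainTheorem7 :
    (¬ LeviRep.HasFaithfulRep LeviRep.L85 5 ∧ LeviRep.mu LeviRep.L85 = 6 ∧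
      ∀ φ : LeviRep.MatRep LeviRep.so3 5, ¬ LeviRep.HasCommutingCopy φ LeviRep.R5) ∧
    (¬ LeviRep.HasFaithfulRep LeviRep.L821 5 ∧ LeviRep.mu LeviRep.L821 = 6 ∧
      ∀ φ : LeviRep.MatRep LeviRep.sl2 5, ¬ LeviRep.HasCommutingCopy φ LeviRep.D2) :=
  ⟨⟨fun h => h.exists_hasCommutingCopy.elim (LeviRep.not_hasCommutingCopy_R5 le_rfl),
      LeviRep.mu_semidirect_eq LeviRep.R5_injective
        fun _ hN => LeviRep.not_hasCommutingCopy_R5 hN,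
      LeviRep.not_hasCommutingCopy_R5 le_rfl⟩,
    fun h => h.exists_hasCommutingCopy.elim (LeviRep.not_hasCommutingCopy_D2 le_rfl),
    LeviRep.mu_semidirect_eq LeviRep.D2_injective
      fun _ hN => LeviRep.not_hasCommutingCopy_D2 hN,
    LeviRep.not_hasCommutingCopy_D2 le_rfl⟩
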